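/- Let $\mathcal{L}\subseteq\{+,-,0\}^E$ be the set of covectors of an oriented matroid without loops on a finite ground set $E$, ordered by $X\le Y$ iff $X_e\in\{0,Y_e\}$ for all $e\in E$. For $e\in E$ the closed halfspaces are $H_e^+=\{X\in\mathcal{L}: X_e\in\{+,0\}\}$ and $H_e^-=\{X\in\mathcal{L}: X_e\in\{-,0\}\}$, and $H_e=H_e^+\cap H_e^-$. A polyhedron in $\mathcal{L}$ is an intersection of closed halfspaces (the empty intersection being $\mathcal{L}$). The rank of a covector is its rank in the poset $\mathcal{L}$ (the zero covector having rank $0$), and the rank of a polyhedron is the common rank of its maximal covectors. An accessible face of a polyhedron $P$ is a set $P\cap H_e$ with $P\subseteq H_e^+$ or $P\subseteq H_e^-$; a face of $P$ is an intersection of accessible faces of $P$ (the empty intersection being $P$). A polyhedral complex in $\mathcal{L}$ is a finite nonempty collection $\mathcal{C}$ of polyhedra such that every face of a member of $\mathcal{C}$ is in $\mathcal{C}$, and $F\cap G$ is a face of $F$ and of $G$ for all $F,G\in\mathcal{C}$. Let $\mathcal{M}$ be a finite collection of polyhedra in $\mathcal{L}$, all of rank $d$. Suppose: (i) the union $\bigcup_{M\in\mathcal{M}}M$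 is a polyhedron in $\mathcal{L}$; and (ii) $M\cap N$ is a face of $M$ and of $N$ for all $M,N\in\mathcal{M}$ with $\operatorname{rank}(M\cap N)\ge d-1$. Then the collection of all polyhedra in $\mathcal{M}$ and all their faces is a polyhedral complex in $\mathcal{L}$. -/

import Mathlib

/-- Sign vectors `X ∈ {+, -, 0}^E`, with `+`, `-`, `0` encoded as `1`, `-1`, `0`. -/
def SignVector (E : Type*) : Type _ := E → SignType

namespace SignVector

variable {E : Type*}

/-- The face order: `X ≤ Y` if every nonzero component of `X` agrees with that of `Y`
(this is not the pointwise order on `SignType`, where `-1 < 0 < 1`). -/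
instance : PartialOrder (SignVector E) where
  le X Y := ∀ e, X e = 0 ∨ X e = Y e
  le_refl _ _ := Or.inr rfl
  le_trans X Y Z h₁ h₂ e := by
    rcases h₁ e with h | h
    · exact Or.inl h
    · rw [h]; exact h₂ e
  le_antisymm X Y h₁ h₂ := by
    funext e
    rcases h₁ e with h | h
    · rcases h₂ e with h' | h'
      · rw [h, h']
      · exact h'.symm
    · exact h

/-- The zero sign vector. -/
def zero : SignVector E := fun _ => 0

/-- The opposite sign vector `-X`. -/
def opp (X : SignVector E) : SignVector E := fun e => -X e

/-- The composition `X ∘ Y`. -/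
def comp (X Y : SignVector E) : SignVector E := fun e => if X e = 0 then Y e else X e

/-- The separation set `S(X, Y)`. -/
def sep (X Y : SignVector E) : Set E := {e | X e ≠ 0 ∧ X e = -Y e}

end SignVector

/-- An oriented matroid on the ground set `E`, given by its set of covectors
through the standard covector axioms. -/
structure OrientedMatroid (E : Type*) where
  covectors : Set (SignVector E)
  zero_mem : SignVector.zero ∈ covectors
  opp_mem : ∀ X ∈ covectors, X.opp ∈ covectors
  comp_mem : ∀ X ∈ covectors, ∀ Y ∈ covectors, X.comp Y ∈ covectors
  elimination : ∀ X ∈ covectors, ∀ Y ∈ covectors, ∀ e ∈ X.sep Y,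
    ∃ Z ∈ covectors, Z e = 0 ∧ ∀ f, f ∉ X.sep Y → Z f = X.comp Y f

namespace OrientedMatroid

variable {E : Type*} (L : OrientedMatroid E)

/-- No element of `E` is a loop: each has a nonzero component in some covector. -/
def Loopless : Prop := ∀ e : E, ∃ X ∈ L.covectors, X e ≠ 0

/-- The covectors of `L`, as a poset under the face order. -/
abbrev Covector : Type _ := {X : SignVector E // X ∈ L.covectors}

/-- The closed halfspace `H_e^+`. -/
def posHalfspace (e : E) : Set L.Covector := {X | X.1 e = 1 ∨ X.1 e = 0}

/-- The closed halfspace `H_e^-`. -/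
def negHalfspace (e : E) : Set L.Covector := {X | X.1 e = -1 ∨ X.1 e = 0}

/-- The hyperplane `H_e = H_e^+ ∩ H_e^-`. -/
def hyperplane (e : E) : Set L.Covector := L.posHalfspace e ∩ L.negHalfspace e

variable {L}

/-- `H` is a closed halfspace `H_e^+` or `H_e^-`. -/
def IsClosedHalfspace (H : Set L.Covector) : Prop :=
  ∃ e : E, H = L.posHalfspace e ∨ H = L.negHalfspace e

/-- A polyhedron is an intersection of closed halfspaces; the empty intersection is the set
of all covectors. -/
def IsPolyhedron (P : Set L.Covector) : Prop :=
  ∃ S : Set (Set L.Covector), (∀ H ∈ S, IsClosedHalfspace H) ∧ P = ⋂₀ S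

/-- The rank of a covector: its rank in the face lattice, i.e. the maximal length of a chain of
covectors ending in it (the zero covector has rank `0`). -/
noncomputable def covectorRank (X : L.Covector) : ℕ∞ := Order.height X

/-- The rank of a polyhedron: the rank of its maximal covectors (all of them have the same rank,
which is the largest rank of a covector in the polyhedron). -/
noncomputable def rank (P : Set L.Covector) : ℕ∞ :=
  ⨆ X ∈ P, covectorRank X

/-- An accessible face of `P` is `P ∩ H_e` where `P` lies on one side of `H_e`. -/
def IsAccessibleFace (G P : Set L.Covector) : Prop :=
  ∃ e : E, (P ⊆ L.posHalfspace e ∨ P ⊆ L.negHalfspace e) ∧ G = P ∩ L.hyperplane e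

/-- A face of `P` is an intersection of accessible faces of `P`, the empty intersection
being `P`. -/
def IsFace (F P : Set L.Covector) : Prop :=
  ∃ S : Set (Set L.Covector), (∀ G ∈ S, IsAccessibleFace G P) ∧ F = P ∩ ⋂₀ S

/-- A polyhedral complex: a finite nonempty collection of polyhedra, closed under taking faces,
in which any two members intersect in a common face. -/
structure IsPolyhedralComplex (C : Set (Set L.Covector)) : Prop where
  finite : C.Finite
  nonempty : C.Nonempty
  isPolyhedron : ∀ F ∈ C, IsPolyhedron F
  face_mem : ∀ F ∈ C, ∀ G, IsFace G F → G ∈ C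
  inter_isFace : ∀ F ∈ C, ∀ G ∈ C, IsFace (F ∩ G) F ∧ IsFace (F ∩ G) G

/-- The support of a collection of polyhedra is their union. -/
def support (M : Set (Set L.Covector)) : Set L.Covector := ⋃₀ M

end OrientedMatroid

namespace SignVector

variable {E : Type*}

/-! Everything reduces to one local statement: for `X ∈ P ∩ Q` with `P, Q ∈ M`, the smallest faces
`minFace P X` and `minFace Q X` coincide. This passes to faces (`IsFace.minFace_eq`), and it makes
intersections common faces (`isFace_inter_of_minFace_eq`): an intersection is the smallest face at
any of its maximal covectors.

To prove it, choose covectors `S ∈ P` and `T ∈ Q` of rank `d` above `X` and walk from `S` to `T`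
while staying above `X` (`minFace_eq_of_gallery`). Each step leaves `S` through a facet `W` that
keeps all signs shared with `T`, and enters `W ∘ T`. This covector lies in the union because the
union is a polyhedron, so it lies in some `P' ∈ M`. Since `W ∈ P ∩ P'` has rank at least `d - 1`,
hypothesis (ii) applies and the smallest face at `X` is unchanged.

The oriented matroid input is that rank depends only on supports (`height_supp`) and that suitable
facets exist (`exists_covBy_of_ne`). -/

instance [Finite E] : Finite (SignVector E) := inferInstanceAs (Finite (E → SignType))

end SignVector

namespace OrientedMatroid

variable {E : Type*} {L : OrientedMatroid E}

/-! ### Composition, elimination, and rank in terms of supports -/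

namespace Covector

/-- The composition of two covectors. -/
def comp (X Y : L.Covector) : L.Covector := ⟨X.1.comp Y.1, L.comp_mem _ X.2 _ Y.2⟩

/-- The opposite covector. -/
def opp (X : L.Covector) : L.Covector := ⟨X.1.opp, L.opp_mem _ X.2⟩

/-- The zero covector. -/
def zero : L.Covector := ⟨SignVector.zero, L.zero_mem⟩

@[simp] theorem opp_apply (X : L.Covector) (e : E) : X.opp.1 e = -X.1 e := rfl

theorem comp_apply (X Y : L.Covector) (e : E) :
    (X.comp Y).1 e = if X.1 e = 0 then Y.1 e else X.1 e := rfl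

theorem comp_apply_of_eq {X : L.Covector} {e : E} (h : X.1 e = 0) (Y : L.Covector) :
    (X.comp Y).1 e = Y.1 e := if_pos h

theorem comp_apply_of_ne {X : L.Covector} {e : E} (h : X.1 e ≠ 0) (Y : L.Covector) :
    (X.comp Y).1 e = X.1 e := if_neg h

theorem comp_eq_zero_iff {X Y : L.Covector} {e : E} :
    (X.comp Y).1 e = 0 ↔ X.1 e = 0 ∧ Y.1 e = 0 := by
  rw [comp_apply]; split_ifs with h <;> simp [h]

theorem le_iff {X Y : L.Covector} : X ≤ Y ↔ ∀ e, X.1 e = 0 ∨ X.1 e = Y.1 e := Iff.rfl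

theorem eq_of_le {X Y : L.Covector} (h : X ≤ Y) {e : E} (he : X.1 e ≠ 0) : X.1 e = Y.1 e :=
  (h e).resolve_left he

theorem eq_zero_of_le {X Y : L.Covector} (h : X ≤ Y) {e : E} (he : Y.1 e = 0) : X.1 e = 0 :=
  (h e).elim id fun h' => h'.trans he

theorem exists_of_lt {X Y : L.Covector} (h : X < Y) : ∃ e, X.1 e = 0 ∧ Y.1 e ≠ 0 := by
  by_contra! hc
  refine h.not_ge fun e => ?_
  rcases h.le e with h0 | h0
  · exact Or.inl (hc e h0)
  · exact Or.inr h0.symm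

theorem le_comp (X Y : L.Covector) : X ≤ X.comp Y := fun e => by
  by_cases h : X.1 e = 0
  · exact Or.inl h
  · exact Or.inr (comp_apply_of_ne h Y).symm

theorem zero_le (X : L.Covector) : zero ≤ X := fun _ => Or.inl rfl

/-- Covector elimination, in a form with the separating condition spelled out. -/
theorem exists_elimination {X Y : L.Covector} {e : E} (he : X.1 e ≠ 0) (hXY : X.1 e = -Y.1 e) :
    ∃ Z : L.Covector, Z.1 e = 0 ∧
      ∀ f, (X.1 f = 0 ∨ X.1 f ≠ -Y.1 f) → Z.1 f = (X.comp Y).1 f := by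
  obtain ⟨Z, hZ, hZe, hZf⟩ := L.elimination X.1 X.2 Y.1 Y.2 e ⟨he, hXY⟩
  refine ⟨⟨Z, hZ⟩, hZe, fun f hf => hZf f ?_⟩
  rintro ⟨h1, h2⟩
  exact hf.elim h1 fun h => h h2

/-- The support of a covector, as an element of the poset of all supports. -/
def supp (X : L.Covector) : {A : Set E // ∃ X : L.Covector, A = {e | X.1 e ≠ 0}} :=
  ⟨{e | X.1 e ≠ 0}, X, rfl⟩

theorem supp_le_iff {X Y : L.Covector} : X.supp ≤ Y.supp ↔ ∀ e, Y.1 e = 0 → X.1 e = 0 :=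
  ⟨fun h _ he => by_contra fun h' => h h' he, fun h _ he h' => he (h _ h')⟩

theorem supp_lt_iff {X Y : L.Covector} :
    X.supp < Y.supp ↔ (∀ e, Y.1 e = 0 → X.1 e = 0) ∧ ∃ e, X.1 e = 0 ∧ Y.1 e ≠ 0 := by
  rw [lt_iff_le_not_ge, supp_le_iff, supp_le_iff]
  push Not
  rfl

theorem supp_strictMono : StrictMono (supp : L.Covector → _) := fun _ _ h =>
  supp_lt_iff.2 ⟨fun _ => eq_zero_of_le h.le, exists_of_lt h⟩

/-- Elimination up to sign: `Z` vanishes at `e` and agrees with `X` off the support of `Y`. -/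
theorem exists_vanishing {X Y : L.Covector} {e : E} (hX : X.1 e ≠ 0) (hY : Y.1 e ≠ 0) :
    ∃ Z : L.Covector, Z.1 e = 0 ∧ (∀ f, X.1 f = 0 → Y.1 f = 0 → Z.1 f = 0) ∧
      ∀ f, Y.1 f = 0 → Z.1 f = X.1 f := by
  obtain ⟨Y', hY', hXY⟩ : ∃ Y' : L.Covector, (∀ f, Y'.1 f = 0 ↔ Y.1 f = 0) ∧
      X.1 e = -Y'.1 e := by
    -- Replacing `Y` by its opposite if necessary makes `e` separating without changing the support.
    by_cases h : X.1 e = -Y.1 e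
    · exact ⟨Y, fun _ => Iff.rfl, h⟩
    · refine ⟨Y.opp, fun f => by rw [opp_apply]; generalize Y.1 f = s; decide +revert, ?_⟩
      rw [opp_apply]
      generalize X.1 e = s at *
      generalize Y.1 e = t at *
      decide +revert
  obtain ⟨Z, hZe, hZ⟩ := exists_elimination hX hXY
  refine ⟨Z, hZe, fun f h h' => ?_, fun f h => ?_⟩
  · rw [hZ f (Or.inl h), comp_apply_of_eq h, (hY' f).2 h']
  · have h' := (hY' f).2 h
    by_cases h0 : X.1 f = 0
    · rw [hZ f (Or.inl h0), comp_apply_of_eq h0, h0, h']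
    · rw [hZ f (Or.inr (by rw [h']; simpa using h0)), comp_apply_of_ne h0]

theorem _root_.Order.exists_lt_height_le_add_one {α : Type*} [PartialOrder α] [Finite α] {x : α}
    (hx : ¬ IsMin x) : ∃ y < x, Order.height x ≤ Order.height y + 1 := by
  obtain ⟨y, hy, hmax⟩ := Set.exists_max_image (Set.Iio x) Order.height (Set.toFinite _)
    (not_isMin_iff.1 hx)
  refine ⟨y, hy, ?_⟩
  rw [Order.height_eq_iSup_lt_height]
  exact iSup₂_le fun z hz => add_le_add_left (hmax z hz) 1

/-- Deleting one element from the support costs at most one unit of rank. -/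
theorem exists_height_supp_le [Finite E] (S : L.Covector) {a : E} (ha : S.1 a ≠ 0) :
    ∃ X : L.Covector, X.1 a = 0 ∧ X.supp ≤ S.supp ∧
      Order.height S.supp ≤ Order.height X.supp + 1 := by
  induction hA : S.supp using WellFoundedLT.induction generalizing S with
  | ind A ih =>
    subst hA
    have hmin : ¬ IsMin S.supp := not_isMin_iff.2
      ⟨zero.supp, supp_lt_iff.2 ⟨fun _ _ => rfl, a, rfl, ha⟩⟩
    obtain ⟨⟨_, S', rfl⟩, hB, hh⟩ := Order.exists_lt_height_le_add_one hmin
    change S'.supp < S.supp at hB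
    change _ ≤ Order.height S'.supp + 1 at hh
    by_cases ha' : S'.1 a = 0
    · exact ⟨S', ha', hB.le, hh⟩
    obtain ⟨X', hX'a, hX'S, hX'h⟩ := ih _ hB S' ha' rfl
    obtain ⟨Z, hZa, hZS, hZ⟩ := exists_vanishing ha ha'
    obtain ⟨hS', e, he', he⟩ := supp_lt_iff.1 hB
    rw [supp_le_iff] at hX'S
    -- Passing from `S` to `S'` to `X'` may cost two units of height. Composing with `Z`, which is
    -- nonzero at an element of the support of `S` outside that of `S'`, regains one.
    refine ⟨X'.comp Z, comp_eq_zero_iff.2 ⟨hX'a, hZa⟩, ?_, ?_⟩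
    · exact supp_le_iff.2 fun e he => comp_eq_zero_iff.2 ⟨hX'S e (hS' e he), hZS e he (hS' e he)⟩
    · refine hh.trans (add_le_add_left (hX'h.trans (Order.height_add_one_le ?_)) 1)
      refine supp_lt_iff.2 ⟨fun e he => (comp_eq_zero_iff.1 he).1, e, hX'S e he', ?_⟩
      rw [Ne, comp_eq_zero_iff, hZ e he']
      exact fun h => he h.2

/-- Any covector `Y ≠ S` supported in the support of `S` can be moved below `S` by eliminating
the elements on which it disagrees with `S`. -/
theorem exists_lt_of_ne [Finite E] {S Y : L.Covector} (hYS : ∀ e, S.1 e = 0 → Y.1 e = 0)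
    (hne : Y ≠ S) :
    ∃ Z < S, (∀ e, Y.1 e = S.1 e → Z.1 e = S.1 e) ∧
      (Z = Y ∨ ∀ e, Y.1 e = 0 → Z.1 e = S.1 e) := by
  induction hA : {e | Y.1 e ≠ 0 ∧ Y.1 e ≠ S.1 e} using WellFoundedLT.induction generalizing Y with
  | ind A ih =>
    subst hA
    by_cases hle : Y ≤ S
    · exact ⟨Y, hle.lt_of_ne hne, fun _ h => h, Or.inl rfl⟩
    rw [le_iff] at hle
    push Not at hle
    obtain ⟨e, he, heS⟩ := hle
    have hSe : S.1 e ≠ 0 := fun h => he (hYS e h)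
    have hopp : S.1 e = -Y.1 e := by
      generalize S.1 e = s at *
      generalize Y.1 e = t at *
      decide +revert
    -- `Z₁` equals `S` wherever `Y` vanishes or agrees with `S`, and it vanishes at `e`, so the set
    -- of disagreements shrinks strictly.
    obtain ⟨Z₁, hZe, hZ₁⟩ := exists_elimination hSe hopp
    have hZ₁S : ∀ f, (Y.1 f = 0 ∨ Y.1 f = S.1 f) → Z₁.1 f = S.1 f := by
      intro f hf
      rw [hZ₁ f, comp_apply]
      · split_ifs with h
        · rw [hYS f h, h]
        · rfl
      · generalize S.1 f = s at *
        generalize Y.1 f = t at *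
        decide +revert
    have hlt : {f | Z₁.1 f ≠ 0 ∧ Z₁.1 f ≠ S.1 f} < {f | Y.1 f ≠ 0 ∧ Y.1 f ≠ S.1 f} := by
      refine (Set.ssubset_iff_of_subset ?_).2 ⟨e, ⟨he, heS⟩, fun h => h.1 hZe⟩
      rintro f ⟨_, h2⟩
      exact ⟨fun h => h2 (hZ₁S f (Or.inl h)), fun h => h2 (hZ₁S f (Or.inr h))⟩
    have hZ₁ne : Z₁ ≠ S := fun h => hSe (h ▸ hZe)
    have hZ₁supp : ∀ f, S.1 f = 0 → Z₁.1 f = 0 := fun f hf =>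
      (hZ₁S f (Or.inl (hYS f hf))).trans hf
    obtain ⟨Z, hZS, hZ, -⟩ := ih _ hlt hZ₁supp hZ₁ne rfl
    exact ⟨Z, hZS, fun f hf => hZ f (hZ₁S f (Or.inr hf)),
      Or.inr fun f hf => hZ f (hZ₁S f (Or.inl hf))⟩

/-- Take `X` vanishing at some `a` in the support of `S` but not of `W`, at a cost of one unit.
Moving `W ∘ X` below `S` gives a covector between `W` and `S`, hence `W` itself. As `W` vanishes at
`a`, no elimination took place, so `W = W ∘ X` and the support of `X` lies in that of `W`. -/
theorem height_supp_le_add_one_of_covBy [Finite E] {W S : L.Covector} (h : W ⋖ S) :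
    Order.height S.supp ≤ Order.height W.supp + 1 := by
  obtain ⟨a, hWa, hSa⟩ := exists_of_lt h.lt
  obtain ⟨X, hXa, hXS, hX⟩ := exists_height_supp_le S hSa
  rw [supp_le_iff] at hXS
  refine hX.trans (add_le_add_left (Order.height_mono ?_) 1)
  have hYa : (W.comp X).1 a = 0 := comp_eq_zero_iff.2 ⟨hWa, hXa⟩
  obtain ⟨Z, hZS, hZ, hZ'⟩ := exists_lt_of_ne (S := S) (Y := W.comp X)
    (fun e he => comp_eq_zero_iff.2 ⟨eq_zero_of_le h.le he, hXS e he⟩)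
    (fun h' => hSa (h' ▸ hYa))
  have hWZ : W ≤ Z := fun e => by
    by_cases he : W.1 e = 0
    · exact Or.inl he
    · right
      rw [hZ e (by rw [comp_apply_of_ne he, eq_of_le h.le he]), eq_of_le h.le he]
  have hZW : W = Z := hWZ.eq_of_not_lt fun h' => h.2 h' hZS
  rcases hZ' with h' | h'
  · rw [supp_le_iff]
    intro e he
    rw [hZW, h', comp_eq_zero_iff] at he
    exact he.2
  · exact absurd (h' a hYa) (by rw [← hZW, hWa]; exact hSa.symm)

/-- The rank of a covector is the height of its support in the poset of supports. -/
theorem height_supp [Finite E] (S : L.Covector) : Order.height S.supp = covectorRank S := by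
  refine le_antisymm ?_ (Order.height_le_height_apply_of_strictMono _ supp_strictMono S)
  induction S using WellFoundedLT.induction with
  | ind S ih =>
    by_cases hS : S = zero
    · subst hS
      have hmin : IsMin (zero : L.Covector).supp := by
        rintro ⟨_, X, rfl⟩ _
        change zero.supp ≤ X.supp
        exact supp_le_iff.2 fun _ _ => rfl
      rw [Order.height_eq_zero.2 hmin]
      exact bot_le
    · obtain ⟨W, _, hW⟩ := exists_le_covBy_of_lt ((zero_le S).lt_of_ne (Ne.symm hS))
      exact (height_supp_le_add_one_of_covBy hW).trans
        ((add_le_add_left (ih W hW.lt) 1).trans (Order.height_add_one_le hW.lt))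

theorem covectorRank_le [Finite E] {X Y : L.Covector} (h : ∀ e, Y.1 e = 0 → X.1 e = 0) :
    covectorRank X ≤ covectorRank Y := by
  rw [← height_supp, ← height_supp]
  exact Order.height_mono (supp_le_iff.2 h)

theorem covectorRank_le_add_one_of_covBy [Finite E] {W S : L.Covector} (h : W ⋖ S) :
    covectorRank S ≤ covectorRank W + 1 := by
  rw [← height_supp, ← height_supp]
  exact height_supp_le_add_one_of_covBy h

/-- From a covector `S` one can pass towards any other covector `T` of the same support through
a facet of `S` that keeps the signs common to `S` and `T`. -/
theorem exists_covBy_of_ne [Finite E] {S T : L.Covector} (hST : ∀ e, S.1 e = 0 → T.1 e = 0)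
    (hne : T ≠ S) : ∃ W, W ⋖ S ∧ ∀ e, T.1 e = S.1 e → W.1 e = S.1 e := by
  obtain ⟨Z, hZS, hZ, -⟩ := exists_lt_of_ne hST hne
  obtain ⟨W, hZW, hW⟩ := exists_le_covBy_of_lt hZS
  refine ⟨W, hW, fun e he => ?_⟩
  rw [← hZ e he]
  by_cases h0 : Z.1 e = 0
  · rw [h0]
    exact eq_zero_of_le hW.le ((hZ e he).symm.trans h0)
  · exact (eq_of_le hZW h0).symm

end Covector

open Covector

/-! ### Polyhedra and their faces -/

theorem mem_hyperplane {X : L.Covector} {e : E} : X ∈ L.hyperplane e ↔ X.1 e = 0 := by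
  simp only [hyperplane, posHalfspace, negHalfspace, Set.mem_inter_iff, Set.mem_ofPred_eq]
  generalize X.1 e = s
  decide +revert

/-- `e` is constantly nonnegative or constantly nonpositive on `P`. -/
def IsSupporting (P : Set L.Covector) (e : E) : Prop :=
  P ⊆ L.posHalfspace e ∨ P ⊆ L.negHalfspace e

theorem IsPolyhedron.mem_of_forall {P : Set L.Covector} (hP : IsPolyhedron P) {X : L.Covector}
    (hpos : ∀ e, P ⊆ L.posHalfspace e → X ∈ L.posHalfspace e)
    (hneg : ∀ e, P ⊆ L.negHalfspace e → X ∈ L.negHalfspace e) : X ∈ P := by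
  obtain ⟨S, hS, rfl⟩ := hP
  intro H hH
  obtain ⟨e, rfl | rfl⟩ := hS H hH
  · exact hpos e (Set.sInter_subset_of_mem hH)
  · exact hneg e (Set.sInter_subset_of_mem hH)

/-- A covector each of whose components is zero, or a component at the same place of a member
of the polyhedron `P`, lies in `P`. -/
theorem IsPolyhedron.mem_of_apply {P : Set L.Covector} (hP : IsPolyhedron P) {X : L.Covector}
    (h : ∀ e, IsSupporting P e → X.1 e = 0 ∨ ∃ Y ∈ P, X.1 e = Y.1 e) : X ∈ P := by
  refine hP.mem_of_forall (fun e he => ?_) fun e he => ?_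
  · rcases h e (Or.inl he) with h0 | ⟨Y, hY, h0⟩
    · exact Or.inr h0
    · have := he hY
      rwa [posHalfspace, Set.mem_ofPred_eq, ← h0] at this
  · rcases h e (Or.inr he) with h0 | ⟨Y, hY, h0⟩
    · exact Or.inr h0
    · have := he hY
      rwa [negHalfspace, Set.mem_ofPred_eq, ← h0] at this

theorem IsPolyhedron.zero_mem {P : Set L.Covector} (hP : IsPolyhedron P) : zero ∈ P :=
  hP.mem_of_apply fun _ _ => Or.inl rfl

theorem IsPolyhedron.mem_of_le {P : Set L.Covector} (hP : IsPolyhedron P) {X Y : L.Covector}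
    (h : X ≤ Y) (hY : Y ∈ P) : X ∈ P :=
  hP.mem_of_apply fun e _ => (h e).imp id fun h' => ⟨Y, hY, h'⟩

theorem IsPolyhedron.comp_mem {P : Set L.Covector} (hP : IsPolyhedron P) {X Y : L.Covector}
    (hX : X ∈ P) (hY : Y ∈ P) : X.comp Y ∈ P :=
  hP.mem_of_apply fun e _ => Or.inr <| by
    rw [comp_apply]
    split_ifs
    exacts [⟨Y, hY, rfl⟩, ⟨X, hX, rfl⟩]

theorem IsPolyhedron.inter {P Q : Set L.Covector} (hP : IsPolyhedron P) (hQ : IsPolyhedron Q) :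
    IsPolyhedron (P ∩ Q) := by
  obtain ⟨S, hS, rfl⟩ := hP
  obtain ⟨T, hT, rfl⟩ := hQ
  exact ⟨S ∪ T, fun H hH => hH.elim (hS H) (hT H), Set.sInter_union S T |>.symm⟩

theorem isPolyhedron_hyperplane (e : E) : IsPolyhedron (L.hyperplane e) :=
  ⟨{L.posHalfspace e, L.negHalfspace e}, by
    rintro H (rfl | rfl)
    exacts [⟨e, Or.inl rfl⟩, ⟨e, Or.inr rfl⟩], (Set.sInter_pair _ _).symm⟩

theorem IsPolyhedron.sInter {S : Set (Set L.Covector)} (hS : ∀ P ∈ S, IsPolyhedron P) :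
    IsPolyhedron (⋂₀ S) := by
  refine ⟨{H | IsClosedHalfspace H ∧ ∃ P ∈ S, P ⊆ H}, fun H hH => hH.1, ?_⟩
  refine Set.Subset.antisymm ?_ ?_
  · rintro X hX H ⟨-, P, hP, hPH⟩
    exact hPH (hX P hP)
  · intro X hX P hP
    exact (hS P hP).mem_of_forall (fun e he => hX _ ⟨⟨e, Or.inl rfl⟩, P, hP, he⟩)
      fun e he => hX _ ⟨⟨e, Or.inr rfl⟩, P, hP, he⟩

theorem isFace_iff {F P : Set L.Covector} :
    IsFace F P ↔ ∃ A : Set E, (∀ e ∈ A, IsSupporting P e) ∧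
      F = {X | X ∈ P ∧ ∀ e ∈ A, X.1 e = 0} := by
  constructor
  · rintro ⟨S, hS, rfl⟩
    refine ⟨{e | IsSupporting P e ∧ P ∩ L.hyperplane e ∈ S}, fun e he => he.1, ?_⟩
    ext X
    refine and_congr_right fun hX => ⟨fun h e he => mem_hyperplane.1 (h _ he.2).2, ?_⟩
    intro h G hG
    obtain ⟨e, he, rfl⟩ := hS G hG
    exact ⟨hX, mem_hyperplane.2 (h e ⟨he, hG⟩)⟩
  · rintro ⟨A, hA, rfl⟩
    refine ⟨(fun e => P ∩ L.hyperplane e) '' A, ?_, ?_⟩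
    · rintro _ ⟨e, he, rfl⟩
      exact ⟨e, hA e he, rfl⟩
    · ext X
      refine and_congr_right fun hX => ⟨?_, fun h e he => ?_⟩
      · rintro h _ ⟨e, he, rfl⟩
        exact ⟨hX, mem_hyperplane.2 (h e he)⟩
      · exact mem_hyperplane.1 (h _ ⟨e, he, rfl⟩).2

theorem IsFace.refl (P : Set L.Covector) : IsFace P P :=
  isFace_iff.2 ⟨∅, by simp, by simp⟩

theorem IsFace.subset {F P : Set L.Covector} (h : IsFace F P) : F ⊆ P := by
  obtain ⟨S, -, rfl⟩ := h
  exact Set.inter_subset_left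

theorem IsFace.isPolyhedron {F P : Set L.Covector} (h : IsFace F P) (hP : IsPolyhedron P) :
    IsPolyhedron F := by
  obtain ⟨S, hS, rfl⟩ := h
  refine hP.inter (IsPolyhedron.sInter fun G hG => ?_)
  obtain ⟨e, -, rfl⟩ := hS G hG
  exact hP.inter (isPolyhedron_hyperplane e)

/-- The smallest face of `P` containing `X`. -/
def minFace (P : Set L.Covector) (X : L.Covector) : Set L.Covector :=
  {Y | Y ∈ P ∧ ∀ e, IsSupporting P e → X.1 e = 0 → Y.1 e = 0}

theorem isFace_minFace (P : Set L.Covector) (X : L.Covector) : IsFace (minFace P X) P :=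
  isFace_iff.2 ⟨{e | IsSupporting P e ∧ X.1 e = 0}, fun _ h => h.1, by
    ext Y
    exact and_congr_right fun _ => ⟨fun h e he => h e he.1 he.2, fun h e h1 h2 => h e ⟨h1, h2⟩⟩⟩

theorem minFace_subset {F P : Set L.Covector} (h : IsFace F P) {X : L.Covector} (hX : X ∈ F) :
    minFace P X ⊆ F := by
  obtain ⟨A, hA, rfl⟩ := isFace_iff.1 h
  exact fun Y hY => ⟨hY.1, fun e he => hY.2 e (hA e he) (hX.2 e he)⟩

theorem comp_opp_mem_minFace {P : Set L.Covector} (hP : IsPolyhedron P) {X Y : L.Covector}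
    (hX : X ∈ P) (hY : Y ∈ minFace P X) : X.comp Y.opp ∈ minFace P X := by
  have key : ∀ e, IsSupporting P e → X.1 e = 0 → (X.comp Y.opp).1 e = 0 := fun e he h0 => by
    rw [comp_apply_of_eq h0, opp_apply, hY.2 e he h0, neg_zero]
  refine ⟨hP.mem_of_apply fun e he => ?_, key⟩
  by_cases h0 : X.1 e = 0
  · exact Or.inl (key e he h0)
  · exact Or.inr ⟨X, hX, comp_apply_of_ne h0 _⟩

/-- If `X` vanishes at a supporting `e`, then `Y` and `X ∘ (-Y)` have opposite signs there, so one
side can contain both only if `Y` vanishes too. With `comp_opp_mem_minFace` this characterizes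
`minFace P X` by membership in `P` alone, which allows comparison between polyhedra. -/
theorem mem_minFace_of_comp_opp_mem {P : Set L.Covector} {X Y : L.Covector} (hY : Y ∈ P)
    (h : X.comp Y.opp ∈ P) : Y ∈ minFace P X := by
  refine ⟨hY, fun e he h0 => ?_⟩
  rcases he with he | he
  · have h1 := he hY
    have h2 := he h
    simp only [posHalfspace, Set.mem_ofPred_eq, comp_apply_of_eq h0, opp_apply] at h1 h2
    generalize Y.1 e = s at *
    decide +revert
  · have h1 := he hY
    have h2 := he h
    simp only [negHalfspace, Set.mem_ofPred_eq, comp_apply_of_eq h0, opp_apply] at h1 h2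
    generalize Y.1 e = s at *
    decide +revert

theorem minFace_subset_minFace {P Q : Set L.Covector} (hP : IsPolyhedron P)
    (h : IsFace (P ∩ Q) P) {X : L.Covector} (hX : X ∈ P ∩ Q) : minFace P X ⊆ minFace Q X :=
  fun _ hY => mem_minFace_of_comp_opp_mem (minFace_subset h hX hY).2
    (minFace_subset h hX (comp_opp_mem_minFace hP hX.1 hY)).2

/-- Smallest faces do not change when passing across a common face. -/
theorem minFace_eq_minFace {P Q : Set L.Covector} (hP : IsPolyhedron P) (hQ : IsPolyhedron Q)
    (h : IsFace (P ∩ Q) P ∧ IsFace (P ∩ Q) Q) {X : L.Covector} (hX : X ∈ P ∩ Q) :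
    minFace P X = minFace Q X :=
  (minFace_subset_minFace hP h.1 hX).antisymm
    (minFace_subset_minFace hQ (Set.inter_comm P Q ▸ h.2) hX.symm)

theorem IsFace.minFace_eq {F P : Set L.Covector} (h : IsFace F P) (hP : IsPolyhedron P)
    {X : L.Covector} (hX : X ∈ F) : minFace F X = minFace P X := by
  refine minFace_eq_minFace (h.isPolyhedron hP) hP ?_ ⟨hX, h.subset hX⟩
  rw [Set.inter_eq_left.2 h.subset]
  exact ⟨IsFace.refl F, h⟩

/-- A polyhedron `K ⊆ P` lies in the smallest face of `P` containing a maximal covector of `K`. -/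
theorem IsPolyhedron.exists_subset_minFace [Finite E] {K : Set L.Covector} (hK : IsPolyhedron K) :
    ∃ X ∈ K, ∀ P, K ⊆ P → K ⊆ minFace P X := by
  obtain ⟨X, hX⟩ := (Set.toFinite K).exists_maximal ⟨_, hK.zero_mem⟩
  refine ⟨X, hX.1, fun P hKP Y hY => ⟨hKP hY, fun e _ h0 => ?_⟩⟩
  have h := hX.eq_of_le (hK.comp_mem hX.1 hY) (le_comp X Y)
  rw [h] at h0
  exact (comp_eq_zero_iff.1 h0).2

theorem IsFace.trans [Finite E] {G F P : Set L.Covector} (hG : IsFace G F) (hF : IsFace F P)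
    (hP : IsPolyhedron P) : IsFace G P := by
  have hFP := hF.isPolyhedron hP
  obtain ⟨X, hX, h⟩ := (hG.isPolyhedron hFP).exists_subset_minFace
  have : G = minFace P X := by
    rw [← hF.minFace_eq hP (hG.subset hX)]
    exact (h F hG.subset).antisymm (minFace_subset hG hX)
  rw [this]
  exact isFace_minFace P X

theorem isFace_inter_of_minFace_eq [Finite E] {F G : Set L.Covector} (hF : IsPolyhedron F)
    (hG : IsPolyhedron G) (h : ∀ X ∈ F ∩ G, minFace F X = minFace G X) :
    IsFace (F ∩ G) F ∧ IsFace (F ∩ G) G := by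
  obtain ⟨X, hX, hK⟩ := (hF.inter hG).exists_subset_minFace
  have hFG := h X hX
  have : F ∩ G = minFace F X := (hK F Set.inter_subset_left).antisymm
    fun Y hY => ⟨hY.1, (hFG ▸ hY : Y ∈ minFace G X).1⟩
  exact ⟨this ▸ isFace_minFace F X, by rw [this, hFG]; exact isFace_minFace G X⟩

/-! ### Galleries of maximal covectors -/

theorem covectorRank_le_rank {P : Set L.Covector} {X : L.Covector} (hX : X ∈ P) :
    covectorRank X ≤ rank P := le_iSup₂_of_le X hX le_rfl

theorem exists_covectorRank_eq [Finite E] {P : Set L.Covector} (hP : P.Nonempty) :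
    ∃ X ∈ P, covectorRank X = rank P := by
  obtain ⟨X, hX, hmax⟩ := Set.exists_max_image P covectorRank (Set.toFinite _) hP
  exact ⟨X, hX, (covectorRank_le_rank hX).antisymm (iSup₂_le hmax)⟩

/-- In a polyhedron, every covector lies below one of the rank of the polyhedron. -/
theorem IsPolyhedron.exists_ge_covectorRank_eq [Finite E] {P : Set L.Covector}
    (hP : IsPolyhedron P) {X : L.Covector} (hX : X ∈ P) :
    ∃ S ∈ P, X ≤ S ∧ covectorRank S = rank P := by
  obtain ⟨T, hT, hrank⟩ := exists_covectorRank_eq ⟨X, hX⟩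
  have hmem := hP.comp_mem hX hT
  refine ⟨X.comp T, hmem, le_comp X T, (covectorRank_le_rank hmem).antisymm ?_⟩
  rw [← hrank]
  exact covectorRank_le fun e he => (comp_eq_zero_iff.1 he).2

/-- Covectors of full finite rank in a polyhedron contain every support. -/
theorem IsPolyhedron.eq_zero_of_covectorRank_eq {U : Set L.Covector} (hU : IsPolyhedron U)
    {d : ℕ} (hd : ∀ X ∈ U, covectorRank X ≤ d) {S T : L.Covector} (hS : S ∈ U) (hT : T ∈ U)
    (hSd : covectorRank S = d) {e : E} (he : S.1 e = 0) : T.1 e = 0 := by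
  have h : S = S.comp T := (le_comp S T).eq_of_not_lt fun hlt => by
    have h1 := Order.height_strictMono hlt (by
      change covectorRank S < ⊤
      rw [hSd]
      exact ENat.natCast_lt_top d)
    change covectorRank S < covectorRank _ at h1
    rw [hSd] at h1
    exact h1.not_ge (hd _ (hU.comp_mem hS hT))
  rw [h] at he
  exact (comp_eq_zero_iff.1 he).2

/-- Induction on the set of elements where `S` and `T` differ, with `T` and `Q` fixed. -/
theorem minFace_eq_of_gallery [Finite E] {M : Set (Set L.Covector)} {d : ℕ}
    (hpoly : ∀ P ∈ M, IsPolyhedron P) (hrank : ∀ X ∈ support M, covectorRank X ≤ d)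
    (hsupp : IsPolyhedron (support M))
    (hface : ∀ P ∈ M, ∀ Q ∈ M, (d : ℕ∞) ≤ rank (P ∩ Q) + 1 →
      IsFace (P ∩ Q) P ∧ IsFace (P ∩ Q) Q)
    {X T : L.Covector} (hXT : X ≤ T) (hTd : covectorRank T = d) {Q : Set L.Covector}
    (hQ : Q ∈ M) (hTQ : T ∈ Q) {S : L.Covector} (hXS : X ≤ S) (hSd : covectorRank S = d)
    {P : Set L.Covector} (hP : P ∈ M) (hSP : S ∈ P) : minFace P X = minFace Q X := by
  induction hA : {e | S.1 e ≠ T.1 e} using WellFoundedLT.induction generalizing S P with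
  | ind A ih =>
    subst hA
    by_cases hST : T = S
    · subst hST
      refine minFace_eq_minFace (hpoly P hP) (hpoly Q hQ) (hface P hP Q hQ ?_)
        ⟨(hpoly P hP).mem_of_le hXT hSP, (hpoly Q hQ).mem_of_le hXT hTQ⟩
      rw [← hTd]
      exact (covectorRank_le_rank (P := P ∩ Q) ⟨hSP, hTQ⟩).trans le_self_add
    have hSU : S ∈ support M := ⟨P, hP, hSP⟩
    have hTU : T ∈ support M := ⟨Q, hQ, hTQ⟩
    obtain ⟨W, hWS, hW⟩ := exists_covBy_of_ne
      (fun e => hsupp.eq_zero_of_covectorRank_eq hrank hSU hTU hSd) hST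
    have hXW : X ≤ W := fun e => by
      by_cases h0 : X.1 e = 0
      · exact Or.inl h0
      · right
        rw [hW e ((eq_of_le hXT h0).symm.trans (eq_of_le hXS h0)), eq_of_le hXS h0]
    have hWU : W ∈ support M := hsupp.mem_of_le hWS.le hSU
    -- Convexity of the union enters here: the next covector of the gallery cannot leave it.
    have hRU := hsupp.comp_mem hWU hTU
    obtain ⟨P', hP', hRP'⟩ := id hRU
    have hRd : covectorRank (W.comp T) = d := (hrank _ hRU).antisymm <| by
      rw [← hTd]
      exact covectorRank_le fun e he => (comp_eq_zero_iff.1 he).2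
    have hWP : W ∈ P := (hpoly P hP).mem_of_le hWS.le hSP
    have hWP' : W ∈ P' := (hpoly P' hP').mem_of_le (le_comp W T) hRP'
    have h1 : minFace P X = minFace P' X := by
      refine minFace_eq_minFace (hpoly P hP) (hpoly P' hP') (hface P hP P' hP' ?_)
        ⟨(hpoly P hP).mem_of_le hXW hWP, (hpoly P' hP').mem_of_le hXW hWP'⟩
      rw [← hSd]
      exact (covectorRank_le_add_one_of_covBy hWS).trans
        (add_le_add_left (covectorRank_le_rank (P := P ∩ P') ⟨hWP, hWP'⟩) 1)
    -- Signs common to `S` and `T` survive in `W ∘ T`. At an element that `W` drops from `S`, the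
    -- new covector agrees with `T` whereas `S` did not.
    refine h1.trans (ih _ ?_ (hXW.trans (le_comp W T)) hRd hP' hRP' rfl)
    obtain ⟨e, hWe, hSe⟩ := exists_of_lt hWS.lt
    refine (Set.ssubset_iff_of_subset fun f hf hSf => ?_).2
      ⟨e, fun h => ?_, fun h => h (comp_apply_of_eq hWe T)⟩
    · rw [Set.mem_ofPred_eq, comp_apply] at hf
      split_ifs at hf with h0
      · exact hf rfl
      · exact hf ((hW f hSf.symm).trans hSf)
    · exact hSe ((hW e h.symm).symm.trans hWe)

end OrientedMatroid

theorem corollary5p3 {E : Type*} [Finite E] (L : OrientedMatroid E) (hL : L.Loopless)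
    (d : ℕ) (M : Set (Set L.Covector)) (hfin : M.Finite)
    (hpoly : ∀ P ∈ M, OrientedMatroid.IsPolyhedron P)
    (hrank : ∀ P ∈ M, OrientedMatroid.rank P = (d : ℕ∞))
    (hsupp : OrientedMatroid.IsPolyhedron (OrientedMatroid.support M))
    (hface : ∀ P ∈ M, ∀ Q ∈ M, (d : ℕ∞) ≤ OrientedMatroid.rank (P ∩ Q) + 1 →
      OrientedMatroid.IsFace (P ∩ Q) P ∧ OrientedMatroid.IsFace (P ∩ Q) Q) :
    OrientedMatroid.IsPolyhedralComplex
      {F : Set L.Covector | F ∈ M ∨ ∃ P ∈ M, OrientedMatroid.IsFace F P} := by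
  open OrientedMatroid in
  have hC : ∀ F, (F ∈ M ∨ ∃ P ∈ M, IsFace F P) → ∃ P ∈ M, IsFace F P := by
    rintro F (hF | hF)
    exacts [⟨F, hF, IsFace.refl F⟩, hF]
  have hUd : ∀ X ∈ support M, covectorRank X ≤ d := by
    rintro X ⟨P, hP, hX⟩
    rw [← hrank P hP]
    exact covectorRank_le_rank hX
  have hmin : ∀ P ∈ M, ∀ Q ∈ M, ∀ X ∈ P ∩ Q, minFace P X = minFace Q X := by
    rintro P hP Q hQ X ⟨hXP, hXQ⟩
    obtain ⟨S, hSP, hXS, hS⟩ := (hpoly P hP).exists_ge_covectorRank_eq hXP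
    obtain ⟨T, hTQ, hXT, hT⟩ := (hpoly Q hQ).exists_ge_covectorRank_eq hXQ
    exact minFace_eq_of_gallery hpoly hUd hsupp hface hXT (hT.trans (hrank Q hQ)) hQ hTQ hXS
      (hS.trans (hrank P hP)) hP hSP
  refine ⟨Set.toFinite _, ?_, ?_, ?_, ?_⟩
  · obtain ⟨P, hP, -⟩ := hsupp.zero_mem
    exact ⟨P, Or.inl hP⟩
  · intro F hF
    obtain ⟨P, hP, hFP⟩ := hC F hF
    exact hFP.isPolyhedron (hpoly P hP)
  · intro F hF G hG
    obtain ⟨P, hP, hFP⟩ := hC F hF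
    exact Or.inr ⟨P, hP, hG.trans hFP (hpoly P hP)⟩
  · intro F hF G hG
    obtain ⟨P, hP, hFP⟩ := hC F hF
    obtain ⟨Q, hQ, hGQ⟩ := hC G hG
    refine isFace_inter_of_minFace_eq (hFP.isPolyhedron (hpoly P hP))
      (hGQ.isPolyhedron (hpoly Q hQ)) fun X hX => ?_
    rw [hFP.minFace_eq (hpoly P hP) hX.1, hGQ.minFace_eq (hpoly Q hQ) hX.2]
    exact hmin P hP Q hQ X ⟨hFP.subset hX.1, hGQ.subset hX.2⟩
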